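/- For a finite simple graph $G$ with $n$ vertices let $L(G)=D(G)-A(G)$ be its Laplacian matrix (the diagonal matrix of vertex degrees minus the adjacency matrix), and let $c_0(G),\dots,c_n(G)$ be the integers defined by $$\det(\lambda I-L(G))=\sum_{s=0}^{n}(-1)^s c_s(G)\,\lambda^{n-s}.$$ Two graphs are called Cmp-cospectral if both are forests and there is a bijection between their sets of components which preserves the number of vertices of components. For simple graphs $G,F$ with the same number $n$ of vertices and the same number $m$ of edges, write $G\succ\!\succ^c F$ if $c_s(G)>c_s(F)$ for every $s\in\{2,\dots,m-1\}$ in case $G$ and $F$ are Cmp-cospectral, and $c_s(G)>c_s(F)$ for every $s\in\{2,\dots,n-1\}$ otherwise. Let $P_n$ denote the path with $n$ vertices. **Theorem.** If $G$ is a tree with $n\ge 4$ vertices and $G$ is not a path, then $P_n\succ\!\succ^c G$; that is, $c_s(P_n)>c_s(G)$ for every $s$ with $2\le s\le n-2$. -/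

import Mathlib

open Classical in
/-- The characteristic polynomial `det (λ I - L(G))` of the Laplacian matrix `L(G) = D(G) - A(G)`
of a finite simple graph `G`. -/
noncomputable def laplacianCharpoly {V : Type*} [Fintype V] (G : SimpleGraph V) : Polynomial ℤ :=
  (G.lapMatrix ℤ).charpoly

/-- The Laplacian coefficients `c_s(G)`, `0 ≤ s ≤ n`, of a graph `G` with `n` vertices, given by
`det (λ I - L(G)) = ∑ s, (-1) ^ s * c_s(G) * λ ^ (n - s)`. -/
noncomputable def laplacianCoeff {V : Type*} [Fintype V] (G : SimpleGraph V) (s : ℕ) : ℤ :=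
  (-1) ^ s * (laplacianCharpoly G).coeff (Fintype.card V - s)

/-- `G` and `F` are `Cmp`-cospectral: both are forests and there is a bijection between their
components which preserves the number of vertices. -/
def CmpCospectral {V W : Type*} (G : SimpleGraph V) (F : SimpleGraph W) : Prop :=
  G.IsAcyclic ∧ F.IsAcyclic ∧
    ∃ σ : G.ConnectedComponent ≃ F.ConnectedComponent,
      ∀ C : G.ConnectedComponent, C.supp.ncard = (σ C).supp.ncard

/-- The relation `G ≻≻^c F` for simple graphs of the same size (`n` vertices and `m` edges):
`c_s(G) > c_s(F)` for all `s ∈ {2, …, m - 1}` if `G` and `F` are `Cmp`-cospectral, and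
for all `s ∈ {2, …, n - 1}` otherwise. -/
def StrictlyCDominates {V W : Type*} [Fintype V] [Fintype W]
    (G : SimpleGraph V) (F : SimpleGraph W) : Prop :=
  Fintype.card V = Fintype.card W ∧
  G.edgeSet.ncard = F.edgeSet.ncard ∧
  (CmpCospectral G F →
    ∀ s : ℕ, 2 ≤ s → s ≤ G.edgeSet.ncard - 1 → laplacianCoeff F s < laplacianCoeff G s) ∧
  (¬ CmpCospectral G F →
    ∀ s : ℕ, 2 ≤ s → s ≤ Fintype.card V - 1 → laplacianCoeff F s < laplacianCoeff G s)

-- The coefficients of `det (X + L(G))` are the `c_s(G)` without signs. Pair this polynomial φ with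
-- the principal minor ψ at a root. Joining roots `r` and `s` by an edge gives φ = φ_G φ_H + φ_G ψ_H
-- + ψ_G φ_H, and ψ = ψ_G (φ_H + ψ_H) at `r`, both monotone in data with nonnegative coefficients.
-- Cutting a tree at an edge of its root shows by induction that end-rooted paths maximize φ and ψ
-- coefficientwise (`IsTree.lapPoly_le`); the key inequality is `pathC p * pathC q ≤ pathC (p + q)`,
-- with defect `X * pathT p * pathT q`.
--
-- For strictness, remove a leaf, leaving a tree H rooted at the leaf's neighbour: φ_G = X φ_H + X
-- ψ_H + φ_H. If H is not a path, φ_H is already strictly smaller in a range of coefficients. If H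
-- is a path and G is not, the leaf hangs from an inner vertex, where ψ_H is a product `pathC p *
-- pathC q` with p, q > 0, so the defect is positive.

open Polynomial

-- Determinants of two blocks joined by an edge

section Determinant

variable {m n R : Type*} [Fintype m] [Fintype n] [DecidableEq m] [DecidableEq n] [CommRing R]

theorem Matrix.det_add_single_self (N : Matrix n n R) (s : n) :
    (N + Matrix.single s s 1).det = N.det + N.adjugate s s := by
  have h : N + Matrix.single s s 1 = N.updateRow s (N s + Pi.single s 1) := by
    ext i j
    by_cases hi : i = s
    · subst hi
      by_cases hj : j = i
      · subst hj; simp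
      · simp [hj, Matrix.single_apply_of_col_ne _ _ (Ne.symm hj)]
    · simp [hi, Matrix.single_apply_of_row_ne (Ne.symm hi)]
  rw [h, Matrix.det_updateRow_add, Matrix.updateRow_eq_self, Matrix.adjugate_apply]

/-- The block matrix obtained from `M ⊕ N` by adding the Laplacian of an edge between
`r` and `s`. -/
def Matrix.edgeJoin (M : Matrix m m R) (N : Matrix n n R) (r : m) (s : n) :
    Matrix (m ⊕ n) (m ⊕ n) R :=
  Matrix.fromBlocks (M + Matrix.single r r 1) (-Matrix.single r s 1)
    (-Matrix.single s r 1) (N + Matrix.single s s 1)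

theorem Matrix.adjugate_edgeJoin_inl (M : Matrix m m R) (N : Matrix n n R) (r : m) (s : n) :
    (M.edgeJoin N r s).adjugate (Sum.inl r) (Sum.inl r) =
      M.adjugate r r * (N.det + N.adjugate s s) := by
  have h : (M.edgeJoin N r s).updateRow (Sum.inl r) (Pi.single (Sum.inl r) 1) =
      Matrix.fromBlocks (M.updateRow r (Pi.single r 1)) 0
        (-Matrix.single s r 1) (N + Matrix.single s s 1) := by
    ext (i | i) (j | j)
    all_goals
      simp only [Matrix.edgeJoin, Matrix.updateRow_apply, Matrix.fromBlocks_apply₁₁,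
        Matrix.fromBlocks_apply₁₂, Matrix.fromBlocks_apply₂₁, Matrix.fromBlocks_apply₂₂,
        Pi.single_apply, Matrix.single_apply, Matrix.add_apply, Matrix.neg_apply,
        Matrix.zero_apply, Sum.inl.injEq, reduceCtorEq, if_false]
      try grind
  rw [Matrix.adjugate_apply, h, Matrix.det_fromBlocks_zero₁₂, Matrix.det_add_single_self,
    ← Matrix.adjugate_apply]

theorem Matrix.det_edgeJoin (M : Matrix m m R) (N : Matrix n n R) (r : m) (s : n) :
    (M.edgeJoin N r s).det =
      M.det * N.det + M.det * N.adjugate s s + M.adjugate r r * N.det := by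
  have h0 : M.edgeJoin N r s = (M.edgeJoin N r s).updateRow (Sum.inl r)
      (Sum.elim (M r) 0 + Sum.elim (Pi.single r 1) (-Pi.single s 1)) := by
    ext (i | i) (j | j)
    all_goals
      simp only [Matrix.edgeJoin, Matrix.updateRow_apply, Matrix.fromBlocks_apply₁₁,
        Matrix.fromBlocks_apply₁₂, Matrix.fromBlocks_apply₂₁, Matrix.fromBlocks_apply₂₂,
        Pi.single_apply, Matrix.single_apply, Matrix.add_apply, Matrix.neg_apply, Pi.add_apply,
        Sum.elim_inl, Sum.elim_inr, Pi.neg_apply, Pi.zero_apply,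
        Sum.inl.injEq, reduceCtorEq, if_false]
      try grind
  have h1 : (M.edgeJoin N r s).updateRow (Sum.inl r) (Sum.elim (M r) 0) =
      Matrix.fromBlocks M 0 (-Matrix.single s r 1) (N + Matrix.single s s 1) := by
    ext (i | i) (j | j)
    all_goals
      simp only [Matrix.edgeJoin, Matrix.updateRow_apply, Matrix.fromBlocks_apply₁₁,
        Matrix.fromBlocks_apply₁₂, Matrix.fromBlocks_apply₂₁, Matrix.fromBlocks_apply₂₂,
        Matrix.single_apply, Matrix.add_apply, Matrix.neg_apply,
        Sum.elim_inl, Sum.elim_inr, Pi.zero_apply, Matrix.zero_apply,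
        Sum.inl.injEq, reduceCtorEq, if_false]
      try grind
  -- Row `r` is split as (row of `M`, 0) + (e_r, -e_s). In the second part, adding row `r` to row
  -- `s` clears the lower left block.
  set K := (M.edgeJoin N r s).updateRow (Sum.inl r) (Sum.elim (Pi.single r 1) (-Pi.single s 1))
    with hK
  have h2 : K.updateRow (Sum.inr s) (K (Sum.inr s) + K (Sum.inl r)) =
      Matrix.fromBlocks (M.updateRow r (Pi.single r 1)) (-Matrix.single r s 1) 0 N := by
    ext (i | i) (j | j)
    all_goals
      simp only [hK, Matrix.edgeJoin, Matrix.updateRow_apply, Matrix.fromBlocks_apply₁₁,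
        Matrix.fromBlocks_apply₁₂, Matrix.fromBlocks_apply₂₁, Matrix.fromBlocks_apply₂₂,
        Pi.single_apply, Matrix.single_apply, Matrix.add_apply, Matrix.neg_apply, Pi.add_apply,
        Sum.elim_inl, Sum.elim_inr, Pi.neg_apply, Matrix.zero_apply,
        Sum.inl.injEq, Sum.inr.injEq, reduceCtorEq, if_false]
      try grind
  have h3 : K.det = M.adjugate r r * N.det := by
    rw [← Matrix.det_updateRow_add_self K (i := Sum.inr s) (j := Sum.inl r) (by simp), h2,
      Matrix.det_fromBlocks_zero₂₁, Matrix.adjugate_apply]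
  rw [h0, Matrix.det_updateRow_add, h1, ← hK, h3, Matrix.det_fromBlocks_zero₁₂,
    Matrix.det_add_single_self]
  ring

end Determinant

-- Laplacian polynomials and the edge-joining formulas

namespace SimpleGraph

open Classical in
/-- The entries of the adjacency matrix, as polynomials. -/
noncomputable def adjX {V : Type*} (G : SimpleGraph V) (i j : V) : ℤ[X] :=
  if G.Adj i j then 1 else 0

theorem adjX_congr {V W : Type*} {G : SimpleGraph V} {H : SimpleGraph W} {a b : V} {c d : W}
    (h : G.Adj a b ↔ H.Adj c d) : G.adjX a b = H.adjX c d := by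
  by_cases ha : G.Adj a b
  · simp [adjX, ha, h.mp ha]
  · simp [adjX, ha, mt h.mpr ha]

open Classical in
/-- The matrix `X + L(G)` over `ℤ[X]`. -/
noncomputable def lapX {V : Type*} [Fintype V] (G : SimpleGraph V) : Matrix V V ℤ[X] :=
  Matrix.diagonal (fun i => X + ∑ k, G.adjX i k) - Matrix.of G.adjX

open Classical in
/-- The polynomial `det (X + L(G))`. -/
noncomputable def lapPoly {V : Type*} [Fintype V] (G : SimpleGraph V) : ℤ[X] := G.lapX.det

open Classical in
/-- The principal minor of `X + L(G)` obtained by deleting the row and column of `r`. -/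
noncomputable def rootedLapPoly {V : Type*} [Fintype V] (G : SimpleGraph V) (r : V) : ℤ[X] :=
  G.lapX.adjugate r r

theorem lapPoly_eq {V : Type*} [Fintype V] [DecidableEq V] (G : SimpleGraph V) :
    G.lapPoly = G.lapX.det := by
  unfold lapPoly
  congr!

theorem rootedLapPoly_eq {V : Type*} [Fintype V] [DecidableEq V] (G : SimpleGraph V) (r : V) :
    G.rootedLapPoly r = G.lapX.adjugate r r := by
  unfold rootedLapPoly
  congr!

/-- The disjoint union of two graphs together with an edge between `r` and `s`. -/
def edgeJoin {V W : Type*} (G : SimpleGraph V) (r : V) (H : SimpleGraph W) (s : W) :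
    SimpleGraph (V ⊕ W) :=
  (G ⊕g H) ⊔ edge (Sum.inl r) (Sum.inr s)

section EdgeJoin

variable {V W : Type*} (G : SimpleGraph V) (r : V) (H : SimpleGraph W) (s : W)

@[simp] theorem edgeJoin_adj_inl_inl (a b : V) :
    (G.edgeJoin r H s).Adj (Sum.inl a) (Sum.inl b) ↔ G.Adj a b := by
  simp [edgeJoin, edge_adj]

@[simp] theorem edgeJoin_adj_inr_inr (a b : W) :
    (G.edgeJoin r H s).Adj (Sum.inr a) (Sum.inr b) ↔ H.Adj a b := by
  simp [edgeJoin, edge_adj]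

@[simp] theorem edgeJoin_adj_inl_inr (a : V) (b : W) :
    (G.edgeJoin r H s).Adj (Sum.inl a) (Sum.inr b) ↔ a = r ∧ b = s := by
  simp [edgeJoin, edge_adj]

@[simp] theorem edgeJoin_adj_inr_inl (a : W) (b : V) :
    (G.edgeJoin r H s).Adj (Sum.inr a) (Sum.inl b) ↔ a = s ∧ b = r := by
  rw [adj_comm, edgeJoin_adj_inl_inr, and_comm]

@[simp] theorem adjX_edgeJoin_inl_inl (a b : V) :
    (G.edgeJoin r H s).adjX (Sum.inl a) (Sum.inl b) = G.adjX a b :=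
  adjX_congr (edgeJoin_adj_inl_inl G r H s a b)

@[simp] theorem adjX_edgeJoin_inr_inr (a b : W) :
    (G.edgeJoin r H s).adjX (Sum.inr a) (Sum.inr b) = H.adjX a b :=
  adjX_congr (edgeJoin_adj_inr_inr G r H s a b)

theorem adjX_edgeJoin_inl_inr [DecidableEq V] [DecidableEq W] (a : V) (b : W) :
    (G.edgeJoin r H s).adjX (Sum.inl a) (Sum.inr b) =
      if a = r then if b = s then 1 else 0 else 0 := by
  by_cases h : a = r <;> by_cases h' : b = s <;> simp [adjX, h, h']

theorem adjX_edgeJoin_inr_inl [DecidableEq V] [DecidableEq W] (a : W) (b : V) :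
    (G.edgeJoin r H s).adjX (Sum.inr a) (Sum.inl b) =
      if a = s then if b = r then 1 else 0 else 0 := by
  by_cases h : a = s <;> by_cases h' : b = r <;> simp [adjX, h, h']

variable [Fintype V] [Fintype W]

theorem lapX_edgeJoin [DecidableEq V] [DecidableEq W] :
    (G.edgeJoin r H s).lapX = G.lapX.edgeJoin H.lapX r s := by
  ext1 i j
  rcases i with i | i <;> rcases j with j | j
  all_goals
    simp only [lapX, Matrix.edgeJoin, Matrix.sub_apply, Matrix.diagonal_apply, Matrix.of_apply,
      Fintype.sum_sum_type, adjX_edgeJoin_inl_inl, adjX_edgeJoin_inl_inr, adjX_edgeJoin_inr_inl,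
      adjX_edgeJoin_inr_inr, Matrix.fromBlocks_apply₁₁,
      Matrix.fromBlocks_apply₁₂, Matrix.fromBlocks_apply₂₁, Matrix.fromBlocks_apply₂₂,
      Matrix.single_apply, Matrix.add_apply, Matrix.neg_apply,
      Sum.inl.injEq, Sum.inr.injEq, reduceCtorEq, if_false, Finset.sum_ite_irrel,
      Finset.sum_ite_eq', Finset.mem_univ, if_true, Finset.sum_const_zero]
    grind

theorem lapPoly_edgeJoin : (G.edgeJoin r H s).lapPoly =
    G.lapPoly * H.lapPoly + G.lapPoly * H.rootedLapPoly s + G.rootedLapPoly r * H.lapPoly := by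
  classical
  simp only [lapPoly_eq, rootedLapPoly_eq]
  rw [lapX_edgeJoin, Matrix.det_edgeJoin]

theorem rootedLapPoly_edgeJoin : (G.edgeJoin r H s).rootedLapPoly (Sum.inl r) =
    G.rootedLapPoly r * (H.lapPoly + H.rootedLapPoly s) := by
  classical
  simp only [lapPoly_eq, rootedLapPoly_eq]
  rw [lapX_edgeJoin, Matrix.adjugate_edgeJoin_inl]

end EdgeJoin

end SimpleGraph

-- Isomorphism invariance and one-vertex graphs

namespace SimpleGraph

section Iso

variable {V W : Type*} [Fintype V] [Fintype W] {G : SimpleGraph V} {H : SimpleGraph W}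

theorem lapX_submatrix_iso (e : G ≃g H) : H.lapX.submatrix e e = G.lapX := by
  classical
  ext1 i j
  have h : ∀ a b, H.adjX (e a) (e b) = G.adjX a b := fun a b => adjX_congr e.map_adj_iff
  have hs : ∑ k, H.adjX (e i) k = ∑ k, G.adjX i k := by
    rw [← e.toEquiv.sum_comp]
    exact Finset.sum_congr rfl fun k _ => h i k
  simp [lapX, Matrix.diagonal_apply, h, hs]

theorem lapPoly_congr (e : G ≃g H) : G.lapPoly = H.lapPoly := by
  classical
  rw [lapPoly_eq, lapPoly_eq, ← lapX_submatrix_iso e]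
  exact Matrix.det_submatrix_equiv_self e.toEquiv _

theorem rootedLapPoly_congr (e : G ≃g H) (r : V) :
    G.rootedLapPoly r = H.rootedLapPoly (e r) := by
  classical
  rw [rootedLapPoly_eq, rootedLapPoly_eq, ← lapX_submatrix_iso e]
  have := congrFun₂ (Matrix.adjugate_submatrix_equiv_self e.toEquiv H.lapX) r r
  exact this

/-- Isomorphisms that match the endpoints of the new edge extend to the edge join. -/
def Iso.edgeJoin {V W V' W' : Type*} {G : SimpleGraph V} {H : SimpleGraph W}
    {G' : SimpleGraph V'} {H' : SimpleGraph W'} (e : G ≃g G') (f : H ≃g H') (r : V) (s : W) :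
    G.edgeJoin r H s ≃g G'.edgeJoin (e r) H' (f s) where
  toEquiv := Equiv.sumCongr e.toEquiv f.toEquiv
  map_rel_iff' := by
    rintro (a | a) (b | b) <;>
      simp [e.map_adj_iff, f.map_adj_iff]

end Iso

theorem lapPoly_of_card_eq_one {V : Type*} [Fintype V] (G : SimpleGraph V)
    (h : Fintype.card V = 1) : G.lapPoly = X := by
  classical
  obtain ⟨v, hv⟩ := Fintype.card_eq_one_iff.mp h
  have : Unique V := ⟨⟨v⟩, hv⟩
  rw [lapPoly_eq, Matrix.det_unique]
  simp [lapX, adjX]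

theorem rootedLapPoly_of_card_eq_one {V : Type*} [Fintype V] (G : SimpleGraph V)
    (h : Fintype.card V = 1) (r : V) : G.rootedLapPoly r = 1 := by
  classical
  have := Fintype.card_le_one_iff_subsingleton.mp h.le
  rw [rootedLapPoly_eq, Matrix.adjugate_subsingleton, Matrix.one_apply_eq]

end SimpleGraph

-- Laplacian coefficients as coefficients of `det (X + L)`

theorem neg_one_pow_mul_coeff_charpoly {V : Type*} [Fintype V] [DecidableEq V]
    (M : Matrix V V ℤ) {s : ℕ} (hs : s ≤ Fintype.card V) :
    (-1) ^ s * M.charpoly.coeff (Fintype.card V - s) =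
      (Matrix.diagonal (fun _ => X) + M.map C).det.coeff (Fintype.card V - s) := by
  -- X + M is minus the characteristic matrix evaluated at -X; this absorbs the alternating signs.
  have h : Matrix.diagonal (fun _ => X) + M.map C =
      -((compRingHom (-X : ℤ[X])).mapMatrix M.charmatrix) := by
    ext1 i j
    by_cases hij : i = j <;> simp [Matrix.charmatrix, hij, add_comm]
  rw [h, Matrix.det_neg, ← RingHom.map_det]
  change _ = ((-1) ^ _ * M.charpoly.comp (-X)).coeff _
  rw [show (-1 : ℤ[X]) = C (-1) by simp, ← C_pow, coeff_C_mul,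
    show (-X : ℤ[X]) = C (-1) * X by simp, comp_C_mul_X_coeff]
  obtain ⟨k, hk⟩ := Nat.exists_eq_add_of_le hs
  have h2 : ((-1 : ℤ) ^ k) * (-1) ^ k = 1 := by rw [← mul_pow]; simp
  rw [hk, Nat.add_sub_cancel_left, pow_add]
  linear_combination (-1 : ℤ) * (-1) ^ s * M.charpoly.coeff k * h2

open Classical in
theorem laplacianCoeff_eq_coeff_lapPoly {V : Type*} [Fintype V] (G : SimpleGraph V) {s : ℕ}
    (hs : s ≤ Fintype.card V) :
    laplacianCoeff G s = G.lapPoly.coeff (Fintype.card V - s) := by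
  rw [laplacianCoeff, laplacianCharpoly, neg_one_pow_mul_coeff_charpoly _ hs,
    SimpleGraph.lapPoly_eq]
  congr 2
  ext1 i j
  have h : ∑ k, G.adjX i k = (G.degree i : ℤ[X]) := by
    rw [SimpleGraph.degree_eq_sum_if_adj]
    simp only [SimpleGraph.adjX]
  by_cases hij : i = j
  · subst hij
    rw [SimpleGraph.lapX, Matrix.sub_apply, Matrix.diagonal_apply_eq, h]
    simp [SimpleGraph.lapMatrix, SimpleGraph.degMatrix, SimpleGraph.adjX]
  · by_cases ha : G.Adj i j <;>
      simp [SimpleGraph.lapX, SimpleGraph.lapMatrix, SimpleGraph.degMatrix, hij, ha,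
        SimpleGraph.adjX]

-- Path polynomials and the coefficientwise order

mutual

/-- `X * pathT n` is `det (X + L(P_n))`. -/
noncomputable def pathT : ℕ → ℤ[X]
  | 0 => 0
  | n + 1 => pathT n + pathC n

/-- The minor of `X + L(P_{n+1})` obtained by deleting an end of the path. -/
noncomputable def pathC : ℕ → ℤ[X]
  | 0 => 1
  | n + 1 => pathC n + X * (pathT n + pathC n)

end

theorem pathT_zero : pathT 0 = 0 := by simp [pathT]
theorem pathT_succ (n : ℕ) : pathT (n + 1) = pathT n + pathC n := by simp [pathT]
theorem pathC_zero : pathC 0 = 1 := by simp [pathC]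
theorem pathC_succ (n : ℕ) : pathC (n + 1) = pathC n + X * pathT (n + 1) := by
  simp [pathC, pathT]

/-- The joining formulas for two paths, with `pathC (p - 1)` eliminated through `pathC p - X * pathT
p`; hence the minus sign. -/
theorem pathT_pathC_add (p q : ℕ) :
    pathC (p + q) = pathC p * pathC q + X * (pathT p * pathT q) ∧
      pathT (p + q) = pathT p * pathC q + pathC p * pathT q - X * (pathT p * pathT q) := by
  induction q with
  | zero => simp [pathT_zero, pathC_zero]
  | succ q ih =>
    have h : pathT (p + (q + 1)) = pathT p * pathC (q + 1) + pathC p * pathT (q + 1) -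
        X * (pathT p * pathT (q + 1)) := by
      rw [← add_assoc, pathT_succ (p + q), ih.1, ih.2, pathC_succ, pathT_succ q]
      ring
    refine ⟨?_, h⟩
    rw [← add_assoc, pathC_succ (p + q), add_assoc, h, ih.1, pathC_succ, pathT_succ q]
    ring

theorem pathT_pathC_coeff (n : ℕ) :
    (∀ k, 0 ≤ (pathT n).coeff k) ∧ (∀ k, 0 ≤ (pathC n).coeff k) ∧
      (∀ k < n, 0 < (pathT n).coeff k) ∧ ∀ k ≤ n, 0 < (pathC n).coeff k := by
  induction n with
  | zero =>
    refine ⟨by simp [pathT_zero], fun k => ?_, by simp, by simp [pathC_zero]⟩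
    rw [pathC_zero, coeff_one]
    split_ifs <;> simp
  | succ n ih =>
    obtain ⟨h1, h2, -, h4⟩ := ih
    have h5 : ∀ k, 0 ≤ (pathT (n + 1)).coeff k := fun k => by
      rw [pathT_succ, coeff_add]; exact add_nonneg (h1 k) (h2 k)
    have h6 : ∀ k < n + 1, 0 < (pathT (n + 1)).coeff k := fun k hk => by
      rw [pathT_succ, coeff_add]
      exact add_pos_of_nonneg_of_pos (h1 k) (h4 k (by omega))
    refine ⟨h5, fun k => ?_, h6, fun k hk => ?_⟩
    · rw [pathC_succ, coeff_add]
      rcases k with _ | k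
      · simpa using h2 0
      · rw [coeff_X_mul]; exact add_nonneg (h2 _) (h5 k)
    · rw [pathC_succ, coeff_add]
      rcases k with _ | k
      · simpa using h4 0 (by omega)
      · rw [coeff_X_mul]; exact add_pos_of_nonneg_of_pos (h2 _) (h6 k (by omega))

/-- The coefficientwise order on integer polynomials. -/
def CoeffLE (p q : ℤ[X]) : Prop := ∀ k, p.coeff k ≤ q.coeff k

namespace CoeffLE

variable {p q r s : ℤ[X]}

theorem refl (p : ℤ[X]) : CoeffLE p p := fun _ => le_rfl

theorem trans (h : CoeffLE p q) (h' : CoeffLE q r) : CoeffLE p r := fun k => (h k).trans (h' k)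

theorem add (h : CoeffLE p q) (h' : CoeffLE r s) : CoeffLE (p + r) (q + s) := fun k => by
  rw [coeff_add, coeff_add]; exact add_le_add (h k) (h' k)

theorem mul (h : CoeffLE p q) (h' : CoeffLE r s) (hp : CoeffLE 0 p) (hr : CoeffLE 0 r) :
    CoeffLE (p * r) (q * s) := fun k => by
  rw [coeff_mul, coeff_mul]
  refine Finset.sum_le_sum fun x _ => mul_le_mul (h _) (h' _) ?_ ?_
  · simpa using hr x.2
  · simpa using (hp x.1).trans (h x.1)

theorem add_nonneg (h : CoeffLE 0 p) (h' : CoeffLE 0 q) : CoeffLE 0 (p + q) := by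
  simpa using h.add h'

theorem mul_nonneg (h : CoeffLE 0 p) (h' : CoeffLE 0 q) : CoeffLE 0 (p * q) := by
  simpa using h.mul h' (refl 0) (refl 0)

theorem X_nonneg : CoeffLE 0 (X : ℤ[X]) := fun k => by
  rw [coeff_X]; split_ifs <;> simp

end CoeffLE

theorem pathT_nonneg (n : ℕ) : CoeffLE 0 (pathT n) := fun k => by
  simpa using (pathT_pathC_coeff n).1 k

theorem pathC_nonneg (n : ℕ) : CoeffLE 0 (pathC n) := fun k => by
  simpa using (pathT_pathC_coeff n).2.1 k

theorem pathC_mul_le (p q : ℕ) : CoeffLE (pathC p * pathC q) (pathC (p + q)) := by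
  rw [(pathT_pathC_add p q).1]
  simpa using (CoeffLE.refl (pathC p * pathC q)).add
    (CoeffLE.X_nonneg.mul_nonneg ((pathT_nonneg p).mul_nonneg (pathT_nonneg q)))

theorem coeff_pathC_mul_lt {p q k : ℕ} (hp : 0 < p) (hq : 0 < q) (hk : 0 < k) (hkn : k < p + q) :
    (pathC p * pathC q).coeff k < (pathC (p + q)).coeff k := by
  obtain ⟨j, rfl⟩ := Nat.exists_eq_add_of_lt hk
  rw [(pathT_pathC_add p q).1, coeff_add, zero_add, coeff_X_mul, lt_add_iff_pos_right, coeff_mul]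
  -- One positive term suffices: here j ≤ (p - 1) + (q - 1), so j splits into exponents below p and
  -- below q, where `pathT` has positive coefficients.
  refine Finset.sum_pos' (fun x _ => mul_nonneg ((pathT_pathC_coeff p).1 _)
    ((pathT_pathC_coeff q).1 _)) ⟨(min j (p - 1), j - min j (p - 1)), ?_, ?_⟩
  · simp
  · exact mul_pos ((pathT_pathC_coeff p).2.2.1 _ (by simp; omega))
      ((pathT_pathC_coeff q).2.2.1 _ (by simp; omega))

-- Path graphs

namespace SimpleGraph

/-- Gluing two paths at their ends gives a path. -/
def pathGraphEdgeJoinIso {p q m : ℕ} (h : p + 1 + (q + 1) = m) :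
    (pathGraph (p + 1)).edgeJoin (Fin.last p) (pathGraph (q + 1)) 0 ≃g pathGraph m where
  toEquiv := finSumFinEquiv.trans (finCongr h)
  map_rel_iff' := by
    rintro (a | a) (b | b) <;>
      simp only [pathGraph_adj, Equiv.trans_apply, finSumFinEquiv_apply_left,
        finSumFinEquiv_apply_right, finCongr_apply, Fin.val_cast, Fin.val_castAdd,
        Fin.val_natAdd, edgeJoin_adj_inl_inl, edgeJoin_adj_inl_inr, edgeJoin_adj_inr_inl,
        edgeJoin_adj_inr_inr, Fin.ext_iff, Fin.val_last, Fin.val_zero] <;> omega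

/-- The reflection of a path. -/
def pathGraphRevIso (n : ℕ) : pathGraph n ≃g pathGraph n where
  toEquiv := Fin.revPerm
  map_rel_iff' := by
    intro a b
    simp [pathGraph_adj]
    omega

theorem lapPoly_pathGraph_aux (n : ℕ) :
    (pathGraph (n + 1)).lapPoly = X * pathT (n + 1) ∧
      (pathGraph (n + 1)).rootedLapPoly 0 = pathC n := by
  induction n with
  | zero =>
    refine ⟨?_, ?_⟩
    · rw [lapPoly_of_card_eq_one _ (by simp), pathT_succ, pathT_zero, pathC_zero]; simp
    · rw [rootedLapPoly_of_card_eq_one _ (by simp), pathC_zero]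
  | succ n ih =>
    have hm : 0 + 1 + (n + 1) = n + 1 + 1 := by omega
    have h0 : pathGraphEdgeJoinIso hm (Sum.inl (Fin.last 0)) = 0 := rfl
    have h1 := lapPoly_congr (pathGraphEdgeJoinIso hm)
    have h2 := rootedLapPoly_congr (pathGraphEdgeJoinIso hm) (Sum.inl (Fin.last 0))
    rw [h0] at h2
    rw [← h1, ← h2, lapPoly_edgeJoin, rootedLapPoly_edgeJoin, ih.1, ih.2,
      lapPoly_of_card_eq_one _ (by simp), rootedLapPoly_of_card_eq_one _ (by simp), pathC_succ,
      pathT_succ (n + 1), pathC_succ]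
    constructor <;> ring

theorem lapPoly_pathGraph {n : ℕ} (hn : 0 < n) : (pathGraph n).lapPoly = X * pathT n := by
  obtain ⟨n, rfl⟩ := Nat.exists_eq_succ_of_ne_zero hn.ne'
  exact (lapPoly_pathGraph_aux n).1

theorem rootedLapPoly_pathGraph_last (n : ℕ) :
    (pathGraph (n + 1)).rootedLapPoly (Fin.last n) = pathC n := by
  rw [rootedLapPoly_congr (pathGraphRevIso (n + 1)), ← (lapPoly_pathGraph_aux n).2]
  congr 1
  simp [pathGraphRevIso]

/-- Cut the path just after `i`: the minor is `pathC p * (X * pathT (q + 1) + pathC q)`, and the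
last factor is `pathC (q + 1)`. -/
theorem rootedLapPoly_pathGraph {p q m : ℕ} (h : p + 1 + (q + 1) = m) (i : Fin m)
    (hi : i.val = p) : (pathGraph m).rootedLapPoly i = pathC p * pathC (q + 1) := by
  have h1 := rootedLapPoly_congr (pathGraphEdgeJoinIso h) (Sum.inl (Fin.last p))
  have h2 : pathGraphEdgeJoinIso h (Sum.inl (Fin.last p)) = i := Fin.ext hi.symm
  rw [rootedLapPoly_edgeJoin, rootedLapPoly_pathGraph_last, (lapPoly_pathGraph_aux q).1,
    (lapPoly_pathGraph_aux q).2, h2] at h1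
  rw [pathC_succ, add_comm (pathC q), h1]

theorem isTree_pathGraph (n : ℕ) : (pathGraph (n + 1)).IsTree := by
  refine ⟨pathGraph_connected n, isAcyclic_iff_forall_adj_isBridge.mpr ?_⟩
  have key : ∀ u v : Fin (n + 1), u.val + 1 = v.val →
      ¬ ((pathGraph (n + 1)).deleteEdges {s(u, v)}).Reachable u v := by
    intro u v huv ⟨w⟩
    -- Without the edge from u to u + 1, no walk leaves the initial segment up to u.
    have h : ∀ a b, ((pathGraph (n + 1)).deleteEdges {s(u, v)}).Walk a b → a ≤ u → b ≤ u := by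
      intro a b w
      induction w with
      | nil => exact id
      | cons hadj _ ih =>
        intro ha
        refine ih ?_
        rw [deleteEdges_adj, pathGraph_adj] at hadj
        by_contra hc
        refine hadj.2 ?_
        simp only [Set.mem_singleton_iff, Sym2.eq_iff, Fin.ext_iff, Fin.le_def] at *
        omega
    have := h u v w le_rfl
    rw [Fin.le_def] at this
    omega
  intro u v huv
  rw [isBridge_iff]
  rcases pathGraph_adj.mp huv with h | h
  · exact key u v h
  · rw [Sym2.eq_swap]
    exact fun hr => key v u h hr.symm

end SimpleGraph

-- Cutting trees and comparing them with paths

namespace SimpleGraph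

/-- Cutting a tree at an edge. -/
theorem IsTree.exists_iso_edgeJoin {V : Type*} {G : SimpleGraph V} (hG : G.IsTree) {r v : V}
    (hrv : G.Adj r v) : ∃ (S : Set V) (hr : r ∈ S) (hv : v ∈ Sᶜ),
      (G.induce S).IsTree ∧ (G.induce Sᶜ).IsTree ∧
      ∃ e : (G.induce S).edgeJoin ⟨r, hr⟩ (G.induce Sᶜ) ⟨v, hv⟩ ≃g G,
        e (Sum.inl ⟨r, hr⟩) = r := by
  classical
  set G' := G.deleteEdges {s(r, v)} with hG'
  have hle : G' ≤ G := deleteEdges_le _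
  have hb : ¬ G'.Reachable r v :=
    isBridge_iff.mp (isAcyclic_iff_forall_adj_isBridge.mp hG.isAcyclic hrv)
  have hadj : ∀ a b, G.Adj a b → G'.Adj a b ∨ (a = r ∧ b = v) ∨ (a = v ∧ b = r) := by
    intro a b hab
    by_cases h : s(a, b) = s(r, v)
    · right; simpa using h
    · left; rw [hG', deleteEdges_adj]; exact ⟨hab, by simpa using h⟩
  have hcover : ∀ w, G'.Reachable w r ∨ G'.Reachable w v := by
    intro w
    obtain ⟨p⟩ := hG.connected.preconnected w r
    have : ∀ a b, G.Walk a b → b = r → G'.Reachable a r ∨ G'.Reachable a v := by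
      intro a b p
      induction p with
      | nil => rintro rfl; exact Or.inl (Reachable.refl _)
      | cons h _ ih =>
        intro hr
        rcases hadj _ _ h with h' | ⟨rfl, -⟩ | ⟨rfl, -⟩
        · exact (ih hr).imp h'.reachable.trans h'.reachable.trans
        · exact Or.inl (Reachable.refl _)
        · exact Or.inr (Reachable.refl _)
    exact this w r p rfl
  -- The two sides of the cut are the components of `r` and `v` once their edge is deleted.
  set c := G'.connectedComponentMk r with hc
  set d := G'.connectedComponentMk v with hd
  have hmem : ∀ w, w ∈ c.supp ↔ G'.Reachable w r := fun w => by
    rw [ConnectedComponent.mem_supp_iff, hc, ConnectedComponent.eq]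
  have hmemd : ∀ w, w ∈ d.supp ↔ G'.Reachable w v := fun w => by
    rw [ConnectedComponent.mem_supp_iff, hd, ConnectedComponent.eq]
  have hcompl : c.suppᶜ = d.supp := by
    ext w
    rw [Set.mem_compl_iff, hmem, hmemd]
    exact ⟨(hcover w).resolve_left, fun h h' => hb (h'.symm.trans h)⟩
  have hconn : ∀ c : G'.ConnectedComponent, (G.induce c.supp).IsTree := fun c =>
    ⟨c.connected_toSimpleGraph.mono (comap_monotone _ hle), hG.isAcyclic.induce _⟩
  have hr : r ∈ c.supp := (hmem r).mpr (Reachable.refl _)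
  have hv : v ∈ c.suppᶜ := by rw [hcompl]; exact (hmemd v).mpr (Reachable.refl _)
  have hcross : ∀ a ∈ c.supp, ∀ b ∈ c.suppᶜ, (G.Adj a b ↔ a = r ∧ b = v) := by
    intro a ha b hb'
    constructor
    · intro h
      rcases hadj a b h with h' | h' | ⟨rfl, rfl⟩
      · exact absurd ((hmem b).mpr (h'.symm.reachable.trans ((hmem a).mp ha))) hb'
      · exact h'
      · exact absurd hr hb'
    · rintro ⟨rfl, rfl⟩; exact hrv
  refine ⟨c.supp, hr, hv, hconn c, hcompl ▸ hconn d,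
    ⟨Equiv.Set.sumCompl c.supp, ?_⟩, ?_⟩
  · rintro (⟨a, ha⟩ | ⟨a, ha⟩) (⟨b, hb'⟩ | ⟨b, hb'⟩)
    · simp
    · simpa using hcross a ha b hb'
    · simpa [adj_comm G a b, and_comm] using hcross b hb' a ha
    · simp
  · rfl

/-- Among rooted trees with `n` vertices, the path rooted at an end maximizes `det (X + L)` and
its root minor coefficientwise. -/
theorem IsTree.lapPoly_le {V : Type*} [Fintype V] {G : SimpleGraph V} (hG : G.IsTree) (r : V)
    {n : ℕ} (hn : Fintype.card V = n + 1) :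
    CoeffLE 0 G.lapPoly ∧ CoeffLE G.lapPoly (X * pathT (n + 1)) ∧
      CoeffLE 0 (G.rootedLapPoly r) ∧ CoeffLE (G.rootedLapPoly r) (pathC n) := by
  classical
  induction n using Nat.strong_induction_on generalizing V with
  | _ n ih =>
  rcases Nat.eq_zero_or_pos n with rfl | hpos
  · rw [lapPoly_of_card_eq_one G hn, rootedLapPoly_of_card_eq_one G hn, pathT_succ, pathT_zero,
      pathC_zero]
    have h1 : CoeffLE 0 (1 : ℤ[X]) := pathC_zero ▸ pathC_nonneg 0
    exact ⟨CoeffLE.X_nonneg, by simpa using CoeffLE.refl X, h1, CoeffLE.refl 1⟩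
  · have : Nontrivial V := Fintype.one_lt_card_iff_nontrivial.mp (by omega)
    obtain ⟨v, hrv⟩ := hG.connected.preconnected.exists_adj_of_nontrivial r
    obtain ⟨S, hr, hv, hS, hS', e, he⟩ := hG.exists_iso_edgeJoin hrv
    have hcard : Fintype.card S + Fintype.card ↥(Sᶜ) = n + 1 := by
      rw [← hn, ← Fintype.card_sum]
      exact Fintype.card_congr e.toEquiv
    have hp : 0 < Fintype.card S := Fintype.card_pos_iff.mpr ⟨⟨r, hr⟩⟩
    have hq : 0 < Fintype.card ↥(Sᶜ) := Fintype.card_pos_iff.mpr ⟨⟨v, hv⟩⟩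
    obtain ⟨p, hp⟩ := Nat.exists_eq_succ_of_ne_zero hp.ne'
    obtain ⟨q, hq⟩ := Nat.exists_eq_succ_of_ne_zero hq.ne'
    obtain rfl : n = p + (q + 1) := by omega
    obtain ⟨a0, a1, b0, b1⟩ := ih p (by omega) hS ⟨r, hr⟩ hp
    obtain ⟨c0, c1, d0, d1⟩ := ih q (by omega) hS' ⟨v, hv⟩ hq
    have hroot := rootedLapPoly_congr e (Sum.inl ⟨r, hr⟩)
    rw [he, rootedLapPoly_edgeJoin] at hroot
    rw [← lapPoly_congr e, ← hroot, lapPoly_edgeJoin]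
    refine ⟨((a0.mul_nonneg c0).add_nonneg (a0.mul_nonneg d0)).add_nonneg (b0.mul_nonneg c0), ?_,
      b0.mul_nonneg (c0.add_nonneg d0), ?_⟩
    · have h := ((a1.mul c1 a0 c0).add (a1.mul d1 a0 d0)).add (b1.mul c1 b0 c0)
      convert h using 1
      have h2 := (pathT_pathC_add (p + 1) (q + 1)).2
      rw [pathC_succ p, pathC_succ q] at h2
      rw [show p + (q + 1) + 1 = p + 1 + (q + 1) by omega, h2]
      ring
    · have h := b1.mul (c1.add d1) b0 (c0.add_nonneg d0)
      rw [add_comm (X * _), ← pathC_succ] at h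
      exact h.trans (pathC_mul_le p (q + 1))

/-- A path with a pendant vertex attached to an end is a path. -/
theorem nonempty_edgeJoin_iso_pathGraph {V W : Type*} [Fintype V] {G : SimpleGraph V}
    (h1 : Fintype.card V = 1) (r : V) {H : SimpleGraph W} {m : ℕ} (f : H ≃g pathGraph (m + 1))
    (s : W) (hs : f s = 0) :
    Nonempty (G.edgeJoin r H s ≃g pathGraph (m + 1 + 1)) := by
  classical
  have hsub := Fintype.card_le_one_iff_subsingleton.mp h1.le
  let g : G ≃g pathGraph (0 + 1) :=
    ⟨Fintype.equivOfCardEq (by simpa using h1), by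
      intro a b
      simp [Subsingleton.elim a b]⟩
  have e := Iso.edgeJoin g f r s
  rw [hs, show g r = Fin.last 0 from Fin.ext (by omega)] at e
  exact ⟨e.trans (pathGraphEdgeJoinIso (by omega))⟩

/-- The bound `3 ≤ n` is carried through the induction because the top coefficient of the range
needs it. -/
theorem IsTree.path_or_coeff_lapPoly_lt {V : Type*} [Fintype V] {G : SimpleGraph V}
    (hG : G.IsTree) {n : ℕ} (hn : Fintype.card V = n + 1) :
    Nonempty (G ≃g pathGraph (n + 1)) ∨
      3 ≤ n ∧ ∀ k, 2 ≤ k → k < n → G.lapPoly.coeff k < (X * pathT (n + 1)).coeff k := by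
  classical
  induction n generalizing V with
  | zero =>
    have hsub := Fintype.card_le_one_iff_subsingleton.mp hn.le
    exact Or.inl ⟨⟨Fintype.equivOfCardEq (by simpa using hn), by
      intro a b
      simp [Subsingleton.elim a b]⟩⟩
  | succ m ih =>
    have : Nontrivial V := Fintype.one_lt_card_iff_nontrivial.mp (by omega)
    obtain ⟨r, hdeg⟩ := hG.exists_vert_degree_one_of_nontrivial
    obtain ⟨v, hrv⟩ := hG.connected.preconnected.exists_adj_of_nontrivial r
    obtain ⟨S, hr, hv, hS, hS', e, he⟩ := hG.exists_iso_edgeJoin hrv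
    have hcard : Fintype.card S + Fintype.card ↥(Sᶜ) = m + 1 + 1 := by
      rw [← hn, ← Fintype.card_sum]
      exact Fintype.card_congr e.toEquiv
    -- `r` is a leaf with neighbour `v`, so a second vertex on its side would force `v` onto that
    -- side.
    have hS1 : Fintype.card S = 1 := by
      by_contra hne
      have : Nontrivial S := Fintype.one_lt_card_iff_nontrivial.mp (by
        have : 0 < Fintype.card S := Fintype.card_pos_iff.mpr ⟨⟨r, hr⟩⟩
        omega)
      obtain ⟨⟨w, hw⟩, hrw⟩ := hS.connected.preconnected.exists_adj_of_nontrivial ⟨r, hr⟩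
      obtain ⟨u, -, hu⟩ := degree_eq_one_iff_existsUnique_adj.mp hdeg
      exact hv (((hu v hrv).trans (hu w hrw).symm) ▸ hw)
    have hS2 : Fintype.card ↥(Sᶜ) = m + 1 := by omega
    obtain ⟨-, hA, -, hB⟩ := hS'.lapPoly_le ⟨v, hv⟩ hS2
    have hA0 := lapPoly_of_card_eq_one (G.induce S) hS1
    have hB0 := rootedLapPoly_of_card_eq_one (G.induce S) hS1 ⟨r, hr⟩
    have hG1 := lapPoly_congr e
    rw [lapPoly_edgeJoin, hA0, hB0, one_mul] at hG1
    have hT : X * pathT (m + 1 + 1) =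
        X * (X * pathT (m + 1)) + X * pathC m + X * pathT (m + 1) := by
      rw [pathT_succ (m + 1), pathC_succ]; ring
    rw [hT, ← hG1]
    simp only [coeff_add]
    rcases ih hS' hS2 with ⟨⟨f⟩⟩ | ⟨hm, hlt⟩
    · by_cases h0 : f ⟨v, hv⟩ = 0
      · exact Or.inl ((nonempty_edgeJoin_iso_pathGraph hS1 _ f _ h0).map fun g => e.symm.trans g)
      by_cases hl : f ⟨v, hv⟩ = Fin.last m
      · have h0 : f.trans (pathGraphRevIso (m + 1)) ⟨v, hv⟩ = 0 := by
          simp [pathGraphRevIso, hl]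
        exact Or.inl ((nonempty_edgeJoin_iso_pathGraph hS1 _ _ _ h0).map fun g => e.symm.trans g)
      right
      have hi0 : 0 < (f ⟨v, hv⟩).val := Nat.pos_of_ne_zero fun h => h0 (Fin.ext h)
      have hil : (f ⟨v, hv⟩).val < m :=
        lt_of_le_of_ne (Nat.le_of_lt_succ (f ⟨v, hv⟩).isLt) fun h => hl (Fin.ext h)
      obtain ⟨q, hq⟩ := Nat.exists_eq_add_of_lt hil
      refine ⟨by omega, fun k hk hkm => ?_⟩
      obtain ⟨k, rfl⟩ := Nat.exists_eq_add_of_le' (show 1 ≤ k by omega)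
      have hB' : ((G.induce Sᶜ).rootedLapPoly ⟨v, hv⟩).coeff k < (pathC m).coeff k := by
        rw [rootedLapPoly_congr f, rootedLapPoly_pathGraph (q := q) (by omega) _ rfl]
        have := coeff_pathC_mul_lt (q := q + 1) hi0 (by omega) (show 0 < k by omega) (by omega)
        rwa [← add_assoc, ← hq] at this
      simp only [coeff_X_mul]
      have h1 := hA k
      have h2 := hA (k + 1)
      rw [coeff_X_mul] at h2
      linarith
    · right
      refine ⟨by omega, fun k hk hkm => ?_⟩
      obtain ⟨k, rfl⟩ := Nat.exists_eq_add_of_le' (show 1 ≤ k by omega)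
      have h1 := hA k
      have h2 := hA (k + 1)
      have h3 := hB k
      rw [coeff_X_mul _ k, coeff_X_mul _ k, coeff_X_mul (X * pathT (m + 1)), coeff_X_mul (pathC m)]
      -- Strictness comes from the unshifted φ_H, except at k + 1 = m, outside its range. There X
      -- φ_H supplies it, with k = m - 1 ≥ 2.
      rcases Nat.lt_or_ge (k + 1) m with h | h
      · have := hlt (k + 1) (by omega) h
        linarith
      · have := hlt k (by omega) (by omega)
        linarith

end SimpleGraph

-- Cospectrality of trees and the conclusion

theorem SimpleGraph.Preconnected.supp_eq_univ {V : Type*} {G : SimpleGraph V}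
    (hG : G.Preconnected) (C : G.ConnectedComponent) : C.supp = Set.univ := by
  have := hG.subsingleton_connectedComponent
  exact Set.eq_univ_of_forall fun w => Subsingleton.elim _ _

theorem CmpCospectral.of_isTree {V W : Type*} {G : SimpleGraph V} {F : SimpleGraph W}
    (hG : G.IsTree) (hF : F.IsTree) (h : Nat.card V = Nat.card W) : CmpCospectral G F := by
  refine ⟨hG.isAcyclic, hF.isAcyclic, ?_⟩
  have := hG.connected.nonempty
  have := hF.connected.nonempty
  have h1 := hG.connected.preconnected.subsingleton_connectedComponent
  have h2 := hF.connected.preconnected.subsingleton_connectedComponent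
  refine ⟨⟨fun _ => F.connectedComponentMk (Classical.arbitrary W),
    fun _ => G.connectedComponentMk (Classical.arbitrary V),
    fun _ => Subsingleton.elim _ _, fun _ => Subsingleton.elim _ _⟩, fun C => ?_⟩
  rw [hG.connected.preconnected.supp_eq_univ, hF.connected.preconnected.supp_eq_univ, Set.ncard_univ,
    Set.ncard_univ, h]

theorem SimpleGraph.IsTree.ncard_edgeSet {V : Type*} [Fintype V] {G : SimpleGraph V}
    (hG : G.IsTree) : G.edgeSet.ncard + 1 = Fintype.card V := by
  classical
  rw [← hG.card_edgeFinset, ← coe_edgeFinset, Set.ncard_coe_finset]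

theorem mainTheorem5 {V : Type*} [Fintype V] (G : SimpleGraph V) (n : ℕ) (hn : 4 ≤ n)
    (hV : Fintype.card V = n) (hG : G.IsTree)
    (hP : ¬ Nonempty (G ≃g SimpleGraph.pathGraph n)) :
    StrictlyCDominates (SimpleGraph.pathGraph n) G ∧
      ∀ s : ℕ, 2 ≤ s → s ≤ n - 2 →
        laplacianCoeff G s < laplacianCoeff (SimpleGraph.pathGraph n) s := by
  obtain ⟨m, rfl⟩ := Nat.exists_eq_add_of_le' (show 1 ≤ n by omega)
  have hT := SimpleGraph.isTree_pathGraph m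
  have hlt : ∀ s : ℕ, 2 ≤ s → s ≤ m + 1 - 2 →
      laplacianCoeff G s < laplacianCoeff (SimpleGraph.pathGraph (m + 1)) s := by
    intro s hs hsm
    rw [laplacianCoeff_eq_coeff_lapPoly G (by omega),
      laplacianCoeff_eq_coeff_lapPoly _ (by rw [Fintype.card_fin]; omega), Fintype.card_fin, hV,
      SimpleGraph.lapPoly_pathGraph (Nat.succ_pos m)]
    exact ((hG.path_or_coeff_lapPoly_lt hV).resolve_left hP).2 _ (by omega) (by omega)
  have hcard : Fintype.card (Fin (m + 1)) = Fintype.card V := by rw [hV, Fintype.card_fin]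
  have he := hG.ncard_edgeSet
  have he' := hT.ncard_edgeSet
  -- Trees of equal order are `Cmp`-cospectral, so only the range up to (number of edges) - 1 = n -
  -- 2 matters.
  refine ⟨⟨hcard, by omega, fun _ s hs hsm => hlt s hs ?_, fun h => ?_⟩, hlt⟩
  · rw [Fintype.card_fin] at he'
    omega
  · exact absurd (CmpCospectral.of_isTree hT hG (by simpa using hcard)) h
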